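/- Let $N\ge 1$ and $[N]=\{1,\dots,N\}$. Let $R:[N]^2\to[N]^2$ be a bijection which is a set-theoretic solution of the Yang--Baxter equation, i.e. $R_{12}R_{23}R_{12}=R_{23}R_{12}R_{23}$ on $[N]^3$, where $R_{12}=R\times\mathrm{id}$ and $R_{23}=\mathrm{id}\times R$. For $k\ge 2$ let $\mathbb F_R^+$ be the single-vertex $k$-graph associated with $R$, that is, the unital semigroup $$\mathbb F_R^+=\big\langle e^i_s,\ 1\le i\le k,\ s\in[N]\ ;\ e^i_s e^j_t=e^j_{t'}e^i_{s'}\ \text{ whenever } i<j \text{ and } R(s,t)=(t',s')\big\rangle$$ with the degree homomorphism $d:\mathbb F_R^+\to\mathbb N^k$, $d(e^i_s)=\varepsilon_i$. For words $u=s_1\cdots s_n\in[N]^n$ write $e^i_u=e^i_{s_1}\cdots e^i_{s_n}$, and let $R^{n,n}:[N]^n\times[N]^n\to[N]^n\times[N]^n$ be the map induced by the commutation relations: $R^{n,n}(u,v)=(v',u')$, where $e^i_ue^j_v=e^j_{v'}e^i_{u'}$ for $i<j$. An infinite path in $\mathbb F_R^+$ is a family $x=(x(\mathbf m,\mathbf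 n))_{\mathbf m\le\mathbf n\in\mathbb N^k}$ in $\mathbb F_R^+$ with $d(x(\mathbf m,\mathbf n))=\mathbf n-\mathbf m$, $x(\mathbf m,\mathbf m)=1$ and $x(\mathbf m,\mathbf n)\,x(\mathbf n,\mathbf l)=x(\mathbf m,\mathbf l)$; for $\mathbf p\in\mathbb N^k$ put $(\sigma^{\mathbf p}x)(\mathbf m,\mathbf n)=x(\mathbf m+\mathbf p,\mathbf n+\mathbf p)$. The $k$-graph is aperiodic if there is an infinite path $x$ with $\sigma^{\mathbf p}x\ne\sigma^{\mathbf q}x$ for all $\mathbf p\ne\mathbf q$ in $\mathbb N^k$, and periodic otherwise. The solution $R$ is called periodic if its associated $k$-graph is periodic for some, or equivalently for every, $k\ge2$. Then $R$ is periodic if and only if $R^{n,n}=\mathrm{id}$ on $[N]^n\times[N]^n$ for some integer $n\ge 1$. More precisely, for every $k\ge 2$, the $k$-graph associated with $R$ is periodic if and only if $R^{n,n}=\mathrm{id}$ for some $n\ge1$. -/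

import Mathlib

/-! ### Set-theoretic solutions of the Yang-Baxter equation -/

namespace YangBaxter

/-- The leg `R₁₂` of a map `R : X² → X²`, acting on the first two coordinates of `X³`. -/
def leg12 {X : Type*} (R : X × X → X × X) (w : X × X × X) : X × X × X :=
  ((R (w.1, w.2.1)).1, (R (w.1, w.2.1)).2, w.2.2)

/-- The leg `R₂₃` of a map `R : X² → X²`, acting on the last two coordinates of `X³`. -/
def leg23 {X : Type*} (R : X × X → X × X) (w : X × X × X) : X × X × X :=
  (w.1, R w.2)

/-- A set-theoretic solution of the Yang-Baxter equation on `X`: a bijection `R` of `X²` with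
`R₁₂ R₂₃ R₁₂ = R₂₃ R₁₂ R₂₃` on `X³`. -/
structure IsSolution {X : Type*} (R : X × X → X × X) : Prop where
  bijective : Function.Bijective R
  braid : leg12 R ∘ leg23 R ∘ leg12 R = leg23 R ∘ leg12 R ∘ leg23 R

/-- Move one letter `t` from the right of the word `u = u₀ ⋯ u_{l-1}` to its left: starting with
the last letter of `u`, each letter `s` of `u` in turn is exchanged with the moving letter by
`(s, t) ↦ R (s, t)`. The result is the letter on the left together with the new word. -/
def moveLetter {X : Type*} (R : X × X → X × X) :
    {l : ℕ} → (Fin l → X) → X → X × (Fin l → X)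
  | 0, u, t => (t, u)
  | _ + 1, u, t =>
    let p := moveLetter R (Fin.tail u) t
    let q := R (u 0, p.1)
    (q.1, Fin.cons q.2 p.2)

/-- The higher level map `R^{l,m} : [N^l] × [N^m] → [N^m] × [N^l]`, where a word of length `l` is a
function on `Fin l`: the letters of `v` are moved past `u` one after the other, the first one
first. See `word_mul_word` for the commutation relation in the associated semigroup which says
what this map is. -/
def level {X : Type*} (R : X × X → X × X) :
    (l m : ℕ) → (Fin l → X) × (Fin m → X) → (Fin m → X) × (Fin l → X)
  | _, 0, w => (w.2, w.1)
  | l, m + 1, w =>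
    let p := moveLetter R w.1 (w.2 0)
    let q := level R l m (p.2, Fin.tail w.2)
    (Fin.cons p.1 q.1, q.2)

/-! ### The semigroup `𝔽_R⁺` with its degree map -/

/-- The defining relations of `𝔽_R⁺`: `e^i_s e^j_t = e^j_{t'} e^i_{s'}` for `i < j` and
`R (s, t) = (t', s')`. The generator `e^i_s` is the pair `(i, s)`. -/
inductive CommRel {X : Type*} (R : X × X → X × X) (k : ℕ) :
    FreeMonoid (Fin k × X) → FreeMonoid (Fin k × X) → Prop
  | swap (i j : Fin k) (hij : i < j) (s t s' t' : X) (h : R (s, t) = (t', s')) :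
      CommRel R k (FreeMonoid.of (i, s) * FreeMonoid.of (j, t))
        (FreeMonoid.of (j, t') * FreeMonoid.of (i, s'))

/-- The unital semigroup `𝔽_R⁺` on the generators `e^i_s` (`i` one of the `k` colours, `s ∈ X`)
with the commutation relations determined by `R`. -/
abbrev KGraph {X : Type*} (R : X × X → X × X) (k : ℕ) : Type _ :=
  PresentedMonoid (CommRel R k)

namespace KGraph

/-- The generator `e^i_s`. -/
def edge {X : Type*} (R : X × X → X × X) {k : ℕ} (i : Fin k) (s : X) : KGraph R k :=
  PresentedMonoid.of (CommRel R k) (i, s)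

/-- The degree map `d : 𝔽_R⁺ → ℕ^k`, the homomorphism with `d (e^i_s) = ε_i`. -/
def degree {X : Type*} (R : X × X → X × X) (k : ℕ) :
    KGraph R k →* Multiplicative (Fin k → ℕ) :=
  PresentedMonoid.lift (fun g : Fin k × X => Multiplicative.ofAdd (Pi.single g.1 1)) (by
    rintro _ _ ⟨i, j, hij, s, t, s', t', h⟩
    simp [mul_comm])

/-- The element `e^i_u = e^i_{u₀} ⋯ e^i_{u_{l-1}}` for a word `u` of length `l`. -/
def word {X : Type*} (R : X × X → X × X) {k : ℕ} (i : Fin k) {l : ℕ} (u : Fin l → X) :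
    KGraph R k :=
  (List.ofFn fun a => edge R i (u a)).prod

theorem word_succ {X : Type*} (R : X × X → X × X) {k : ℕ} (i : Fin k) {l : ℕ}
    (u : Fin (l + 1) → X) : word R i u = edge R i (u 0) * word R i (Fin.tail u) := by
  simp [word, List.ofFn_succ, Fin.tail]

theorem edge_mul_edge {X : Type*} (R : X × X → X × X) {k : ℕ} {i j : Fin k} (hij : i < j)
    (s t : X) :
    edge R i s * edge R j t = edge R j (R (s, t)).1 * edge R i (R (s, t)).2 :=
  Quotient.sound (ConGen.Rel.of _ _ (CommRel.swap i j hij s t _ _ rfl))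

theorem word_mul_edge {X : Type*} (R : X × X → X × X) {k : ℕ} {i j : Fin k} (hij : i < j) :
    ∀ {l : ℕ} (u : Fin l → X) (t : X),
      word R i u * edge R j t = edge R j (moveLetter R u t).1 * word R i (moveLetter R u t).2
  | 0, u, t => by simp [word, moveLetter]
  | l + 1, u, t => by
    rw [word_succ, mul_assoc, word_mul_edge R hij, ← mul_assoc, edge_mul_edge R hij, mul_assoc]
    simp [moveLetter, word_succ]

/-- The maps `R^{l,m}` are the ones induced by the commutation relations:
`e^i_u e^j_v = e^j_{v'} e^i_{u'}` for `i < j` and `R^{l,m} (u, v) = (v', u')`. -/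
theorem word_mul_word {X : Type*} (R : X × X → X × X) {k : ℕ} {i j : Fin k} (hij : i < j) :
    ∀ {l m : ℕ} (u : Fin l → X) (v : Fin m → X),
      word R i u * word R j v =
        word R j (level R l m (u, v)).1 * word R i (level R l m (u, v)).2
  | l, 0, u, v => by simp [word, level]
  | l, m + 1, u, v => by
    rw [word_succ, ← mul_assoc, word_mul_edge R hij, mul_assoc, word_mul_word R hij]
    simp [level, word_succ, mul_assoc]

end KGraph

end YangBaxter

/-! ### Infinite paths and periodicity of a single-vertex `k`-graph

A single-vertex `k`-graph is a monoid `Λ` (a category with one object) with a degree homomorphism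
`d : Λ → ℕ^k`; the definitions below use only these data. -/

/-- An infinite path in a single-vertex `k`-graph `(Λ, d)`: a degree-preserving functor from
`Ω_k` to `Λ`, where `Ω_k` has the objects `ℕ^k` and one morphism, of degree `n - m`, for each pair
`m ≤ n`. -/
@[ext]
structure InfinitePath {Λ : Type*} [Monoid Λ] {k : ℕ}
    (d : Λ →* Multiplicative (Fin k → ℕ)) where
  seg : ∀ m n : Fin k → ℕ, m ≤ n → Λ
  degree_seg : ∀ m n (h : m ≤ n), d (seg m n h) = Multiplicative.ofAdd (n - m)
  seg_self : ∀ m, seg m m le_rfl = 1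
  seg_mul_seg : ∀ m n l (h : m ≤ n) (h' : n ≤ l),
    seg m n h * seg n l h' = seg m l (h.trans h')

/-- The shift `σ^p`: `(σ^p x)(m, n) = x (m + p, n + p)`. -/
def InfinitePath.shift {Λ : Type*} [Monoid Λ] {k : ℕ} {d : Λ →* Multiplicative (Fin k → ℕ)}
    (p : Fin k → ℕ) (x : InfinitePath d) : InfinitePath d where
  seg m n h := x.seg (m + p) (n + p) (add_le_add_left h p)
  degree_seg m n h := by rw [x.degree_seg, add_tsub_add_eq_tsub_right]
  seg_self m := x.seg_self _
  seg_mul_seg m n l h h' := x.seg_mul_seg _ _ _ _ _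

/-- The Kumjian-Pask aperiodicity condition for a single-vertex `k`-graph: some infinite path `x`
has `σ^p x ≠ σ^q x` for all `p ≠ q` in `ℕ^k`. -/
def IsAperiodicKGraph {Λ : Type*} [Monoid Λ] {k : ℕ}
    (d : Λ →* Multiplicative (Fin k → ℕ)) : Prop :=
  ∃ x : InfinitePath d, ∀ p q : Fin k → ℕ, p ≠ q → x.shift p ≠ x.shift q

/-- A single-vertex `k`-graph is periodic if it is not aperiodic. -/
def IsPeriodicKGraph {Λ : Type*} [Monoid Λ] {k : ℕ}
    (d : Λ →* Multiplicative (Fin k → ℕ)) : Prop :=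
  ¬ IsAperiodicKGraph d

/-! ### Unique factorization and periods in a graded monoid -/

/-! The infinite paths are replaced by a finitary notion: `IsPeriod d p q` says that what follows a
factor of degree p agrees with what follows a factor of degree q. With unique factorization, a
period forces σ^p x = σ^q x for every path x (`shift_eq_of_isPeriod`). If no pair p ≠ q is a period,
one path containing a counterexample to each pair is aperiodic (`isAperiodicKGraph`). Unique
factorization in 𝔽_R⁺ comes from counting: by the Yang–Baxter equation the generators act on tuples
of words, so there are exactly N^{|p|} elements of degree p, and the multiplication maps, being
surjective between finite sets of equal size, are injective.

If R^{n,n} = id, then e^i_u e^j_v = e^j_u e^i_v for words of length n, so a word may change colour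
without changing its letters; this makes (nε_i, nε_j) a period (`isPeriod_of_level_eq_id`).

Conversely, a period with p ≠ q reduces to a period (a, b) with disjoint supports, not both zero. It
gives inverse bijections h, g between degrees a and b with u v = h(u) g(v) (`exists_exchange`). In a
semigroup with twice as many colours, embed the given one by two maps F and G that agree on the
colours of a but separate those of b. Since F = G in degree a, elements of degree a carry
information between the two copies, whence F(w) G(v) = G(w) F(v) in degree b
(`mapColour_mul_mapColour`). Reading off the first and the last words of one colour c gives R^{n,n}
= id with n = b_c. -/

namespace InfinitePath

variable {Λ : Type*} [Monoid Λ] {k : ℕ}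

/-- The degree of an element, written additively. -/
def deg (d : Λ →* Multiplicative (Fin k → ℕ)) (x : Λ) : Fin k → ℕ :=
  Multiplicative.toAdd (d x)

@[simp]
theorem deg_one (d : Λ →* Multiplicative (Fin k → ℕ)) : deg d 1 = 0 := by simp [deg]

@[simp]
theorem deg_mul (d : Λ →* Multiplicative (Fin k → ℕ)) (x y : Λ) :
    deg d (x * y) = deg d x + deg d y := by simp [deg]

/-- The factorization property of a single-vertex `k`-graph, together with the existence of
elements of every degree. -/
structure UniqueFactorization (d : Λ →* Multiplicative (Fin k → ℕ)) : Prop where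
  exists_mul : ∀ x p q, deg d x = p + q → ∃ a b, x = a * b ∧ deg d a = p ∧ deg d b = q
  cancel : ∀ a b a' b', deg d a = deg d a' → a * b = a' * b' → a = a' ∧ b = b'
  exists_deg : ∀ p, ∃ x, deg d x = p

/-- `(p, q)` is a period: what follows a factor of degree `p` in an element agrees with what
follows a factor of degree `q`. -/
def IsPeriod (d : Λ →* Multiplicative (Fin k → ℕ)) (p q : Fin k → ℕ) : Prop :=
  ∀ α β γ α' β' γ', deg d α = p → deg d α' = q → deg d β = deg d β' →
    α * β * γ = α' * β' * γ' → β = β'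

variable {d : Λ →* Multiplicative (Fin k → ℕ)}

theorem IsPeriod.symm {p q : Fin k → ℕ} (h : IsPeriod d p q) : IsPeriod d q p :=
  fun α β γ α' β' γ' h₁ h₂ h₃ h₄ => (h α' β' γ' α β γ h₂ h₁ h₃.symm h₄.symm).symm

namespace UniqueFactorization

variable (H : UniqueFactorization d)
include H

theorem eq_one {x : Λ} (hx : deg d x = 0) : x = 1 :=
  (H.cancel x 1 1 x (by simp [hx]) (by simp)).1

/-- Factorization of elements of degree at least `p`. -/
theorem exists_mul_of_le {x : Λ} {p : Fin k → ℕ} (h : p ≤ deg d x) :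
    ∃ a b, x = a * b ∧ deg d a = p ∧ deg d b = deg d x - p :=
  H.exists_mul x p _ (add_tsub_cancel_of_le h).symm

/-- Any equality of products can be multiplied on the left by an element of degree r. This removes
the common part of a period. -/
theorem isPeriod_of_add {r p q : Fin k → ℕ} (h : IsPeriod d (r + p) (r + q)) :
    IsPeriod d p q := by
  intro α β γ α' β' γ' h₁ h₂ h₃ h₄
  obtain ⟨ρ, hρ⟩ := H.exists_deg r
  refine h (ρ * α) β γ (ρ * α') β' γ' (by simp [hρ, h₁]) (by simp [hρ, h₂]) h₃ ?_
  simp only [mul_assoc] at h₄ ⊢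
  rw [h₄]

/-- A period `(a, b)` provides inverse bijections `h`, `g` between the elements of degree `a` and
those of degree `b`, with `u v = h(u) g(v)`. -/
theorem exists_exchange {a b : Fin k → ℕ} (hab : IsPeriod d a b) :
    ∃ h g : Λ → Λ, (∀ u, deg d u = a → deg d (h u) = b ∧ g (h u) = u) ∧
      (∀ v, deg d v = b → deg d (g v) = a ∧ h (g v) = v) ∧
      ∀ u v, deg d u = a → deg d v = b → u * v = h u * g v := by
  -- The elements x and y are padding: g(v) is the left factor of degree a of v x, and h(u) that of
  -- degree b of u y. The period makes the choice of padding irrelevant. In the wrong degree the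
  -- values are junk.
  obtain ⟨x, hx⟩ := H.exists_deg a
  obtain ⟨y, hy⟩ := H.exists_deg b
  have hg : ∀ v, ∃ s t, deg d v = b → v * x = s * t ∧ deg d s = a ∧ deg d t = b := by
    intro v
    by_cases hv : deg d v = b
    · obtain ⟨s, t, h⟩ := H.exists_mul (v * x) a b (by simp [hv, hx, add_comm])
      exact ⟨s, t, fun _ => h⟩
    · exact ⟨1, 1, fun h => absurd h hv⟩
  have hh : ∀ u, ∃ s t, deg d u = a → u * y = s * t ∧ deg d s = b ∧ deg d t = a := by
    intro v
    by_cases hv : deg d v = a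
    · obtain ⟨s, t, h⟩ := H.exists_mul (v * y) b a (by simp [hv, hy, add_comm])
      exact ⟨s, t, fun _ => h⟩
    · exact ⟨1, 1, fun h => absurd h hv⟩
  choose g g' hg using hg
  choose h h' hh using hh
  -- If u v = v' u', compare what follows degree a with what follows degree b, in u v x for the
  -- first claim and in u v y for the second.
  have key : ∀ u v v' u', deg d u = a → deg d v = b → deg d v' = b → deg d u' = a →
      u * v = v' * u' → g v = u' ∧ v = h u' := by
    intro u v v' u' hu hv hv' hu' e
    constructor
    · refine hab u (g v) (g' v) v' u' x hu hv' (by rw [hu', (hg v hv).2.1]) ?_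
      rw [mul_assoc, ← (hg v hv).1, ← mul_assoc, e]
    · refine hab u v y v' (h u') (h' u') hu hv' (by rw [hv, (hh u' hu').2.1]) ?_
      rw [mul_assoc v', ← (hh u' hu').1, ← mul_assoc, e]
  have key' : ∀ u v v' u', deg d u = a → deg d v = b → deg d v' = b → deg d u' = a →
      v * u = u' * v' → h u = v' ∧ u = g v' := by
    intro u v v' u' hu hv hv' hu' e
    constructor
    · refine hab.symm v (h u) (h' u) u' v' y hv hu' (by rw [hv', (hh u hu).2.1]) ?_
      rw [mul_assoc, ← (hh u hu).1, ← mul_assoc, e]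
    · refine hab.symm v u x u' (g v') (g' v') hv hu' (by rw [hu, (hg v' hv').2.1]) ?_
      rw [mul_assoc u', ← (hg v' hv').1, ← mul_assoc, e]
  have hgh : ∀ u, deg d u = a → g (h u) = u := by
    intro u hu
    obtain ⟨u', v', e, hu', hv'⟩ := H.exists_mul (y * u) a b (by simp [hu, hy, add_comm])
    obtain ⟨h₁, h₂⟩ := key' u y v' u' hu hy hv' hu' e
    rw [h₁, ← h₂]
  have hhg : ∀ v, deg d v = b → h (g v) = v := by
    intro v hv
    obtain ⟨v', u', e, hv', hu'⟩ := H.exists_mul (x * v) b a (by simp [hv, hx, add_comm])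
    obtain ⟨h₁, h₂⟩ := key x v v' u' hx hv hv' hu' e
    rw [h₁, ← h₂]
  refine ⟨h, g, fun u hu => ⟨(hh u hu).2.1, hgh u hu⟩, fun v hv => ⟨(hg v hv).2.1, hhg v hv⟩, ?_⟩
  intro u v hu hv
  obtain ⟨v', u', e, hv', hu'⟩ := H.exists_mul (u * v) b a (by simp [hu, hv, add_comm])
  have hub := (hh u hu).2.1
  -- Here u₁ = g(h(u)) = u, so x h(u) v = v₀ u v = v₀ v' u', and the period compares h(u) with v'.
  obtain ⟨v₀, u₁, e₀, hv₀, hu₁⟩ := H.exists_mul (x * h u) b a (by simp [hx, hub, add_comm])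
  have h₁ := (key x (h u) v₀ u₁ hx hub hv₀ hu₁ e₀).1
  rw [hgh u hu] at h₁
  rw [e, (key u v v' u' hu hv hv' hu' e).1]
  congr 1
  refine (hab x (h u) v v₀ v' u' hx hv₀ (by rw [hub, hv']) ?_).symm
  rw [e₀, ← h₁, mul_assoc, mul_assoc, e]

/-- The segments of degree n starting at p and at q both lie in the segment from 0 to n + p + q, so
the period identifies them; cancelling initial parts handles the other segments. -/
theorem shift_eq_of_isPeriod {p q : Fin k → ℕ} (h : IsPeriod d p q) (x : InfinitePath d) :
    x.shift p = x.shift q := by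
  have hdeg : ∀ m n (hmn : m ≤ n), deg d (x.seg m n hmn) = n - m := fun m n hmn => by
    simp [deg, x.degree_seg]
  have key : ∀ n : Fin k → ℕ, x.seg p (n + p) le_add_self = x.seg q (n + q) le_add_self := by
    intro n
    refine h (x.seg 0 p zero_le) _ (x.seg (n + p) (n + p + q) le_self_add)
      (x.seg 0 q zero_le) _
      (x.seg (n + q) (n + p + q) (by rw [add_right_comm]; exact le_self_add)) ?_ ?_ ?_ ?_
    · simp [hdeg]
    · simp [hdeg]
    · simp [hdeg]
    · simp only [x.seg_mul_seg]
  ext m n hmn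
  refine (H.cancel (x.seg p (m + p) le_add_self) _ (x.seg q (m + q) le_add_self) _ ?_ ?_).2
  · simp [hdeg]
  · simp only [shift, x.seg_mul_seg]
    exact key n

/-- A sequence of elements, each a left factor of the next one and with degrees tending to
infinity, determines an infinite path. -/
theorem exists_infinitePath (A : ℕ → Λ) (hA : ∀ n, ∃ y, A (n + 1) = A n * y)
    (hdeg : ∀ n c, n ≤ deg d (A n) c) :
    ∃ x : InfinitePath d, ∀ M m n h α β γ, A M = α * β * γ → deg d α = m → deg d β = n - m →
      x.seg m n h = β := by
  have hmono : ∀ m n, m ≤ n → ∃ y, A n = A m * y := by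
    intro m n hmn
    induction n, hmn using Nat.le_induction with
    | base => exact ⟨1, by simp⟩
    | succ n _ ih =>
      obtain ⟨y, hy⟩ := ih
      obtain ⟨z, hz⟩ := hA n
      exact ⟨y * z, by rw [hz, hy, mul_assoc]⟩
  have huniq' : ∀ M M', M ≤ M' → ∀ α β γ α' β' γ', A M = α * β * γ → A M' = α' * β' * γ' →
      deg d α = deg d α' → deg d β = deg d β' → β = β' := by
    intro M M' hM α β γ α' β' γ' e e' h₁ h₂
    obtain ⟨y, hy⟩ := hmono M M' hM
    rw [e', e] at hy
    simp only [mul_assoc] at hy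
    exact ((H.cancel _ _ _ _ h₂.symm (H.cancel _ _ _ _ h₁.symm hy).2).1).symm
  have huniq : ∀ M M' α β γ α' β' γ', A M = α * β * γ → A M' = α' * β' * γ' →
      deg d α = deg d α' → deg d β = deg d β' → β = β' := by
    intro M M' α β γ α' β' γ' e e' h₁ h₂
    rcases le_total M M' with h | h
    · exact huniq' _ _ h _ _ _ _ _ _ e e' h₁ h₂
    · exact (huniq' _ _ h _ _ _ _ _ _ e' e h₁.symm h₂.symm).symm
  have hex : ∀ m n : Fin k → ℕ, m ≤ n → ∃ β M α γ, A M = α * β * γ ∧ deg d α = m ∧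
      deg d β = n - m := by
    intro m n hmn
    have hn : n ≤ deg d (A (∑ c, n c)) := fun c =>
      (Finset.single_le_sum (f := n) (fun _ _ => zero_le) (Finset.mem_univ c)).trans (hdeg _ c)
    obtain ⟨a, γ, e, ha, -⟩ := H.exists_mul_of_le hn
    obtain ⟨α, β, rfl, hα, hβ⟩ := H.exists_mul_of_le (ha.symm ▸ hmn : m ≤ deg d a)
    exact ⟨β, _, α, γ, e, hα, by rw [hβ, ha]⟩
  choose s hs using hex
  refine ⟨⟨s, ?_, ?_, ?_⟩, ?_⟩
  · intro m n h
    obtain ⟨M, α, γ, -, -, h₃⟩ := hs m n h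
    rw [← h₃]
    simp [deg]
  · intro m
    obtain ⟨M, α, γ, -, -, h₃⟩ := hs m m le_rfl
    exact H.eq_one (by simp [h₃])
  · intro m n l h h'
    obtain ⟨M, α, γ, e, h₁, h₂⟩ := hs m l (h.trans h')
    have : n - m ≤ deg d (s m l (h.trans h')) := by rw [h₂]; exact tsub_le_tsub_right h' m
    obtain ⟨β₁, β₂, e', h₃, h₄⟩ := H.exists_mul_of_le this
    rw [h₂, tsub_tsub_tsub_cancel_right h] at h₄
    obtain ⟨M₁, α₁, γ₁, e₁, k₁, k₁'⟩ := hs m n h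
    obtain ⟨M₂, α₂, γ₂, e₂, k₂, k₂'⟩ := hs n l h'
    rw [e'] at e
    rw [e', huniq M₁ M α₁ _ γ₁ α β₁ (β₂ * γ) e₁ (by simp [e, mul_assoc]) (by rw [k₁, h₁])
      (by rw [k₁', h₃]), huniq M₂ M α₂ _ γ₂ (α * β₁) β₂ γ e₂ (by simp [e, mul_assoc])
      (by rw [k₂, deg_mul, h₁, h₃, add_tsub_cancel_of_le h]) (by rw [k₂', h₄])]
  · intro M m n h α β γ e h₁ h₂
    obtain ⟨M₁, α₁, γ₁, e₁, k₁, k₁'⟩ := hs m n h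
    exact huniq M₁ M _ _ _ _ _ _ e₁ e (by rw [k₁, h₁]) (by rw [k₁', h₂])

/-- A single-vertex `k`-graph without periods is aperiodic. -/
theorem isAperiodicKGraph (hper : ∀ p q, p ≠ q → ¬ IsPeriod d p q) : IsAperiodicKGraph d := by
  have hw : ∀ w : (Fin k → ℕ) × (Fin k → ℕ), ∃ x, (∀ c, 1 ≤ deg d x c) ∧ (w.1 ≠ w.2 →
      ∃ α β γ α' β' γ', deg d α = w.1 ∧ deg d α' = w.2 ∧ deg d β = deg d β' ∧ β ≠ β' ∧
        x = α * β * γ ∧ x = α' * β' * γ') := by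
    rintro ⟨p, q⟩
    -- The factor z makes the degree of each block positive in every colour, so that the
    -- concatenated blocks fill all of ℕ^k.
    obtain ⟨z, hz⟩ := H.exists_deg (fun _ => 1)
    by_cases hpq : p = q
    · exact ⟨z, by simp [hz], fun h => absurd hpq h⟩
    · have := hper p q hpq
      simp only [IsPeriod, not_forall] at this
      obtain ⟨α, β, γ, α', β', γ', h₁, h₂, h₃, h₄, h₅⟩ := this
      refine ⟨α * β * γ * z, fun c => by simp [hz], fun _ =>
        ⟨α, β, γ * z, α', β', γ' * z, h₁, h₂, h₃, h₅, by simp [mul_assoc], ?_⟩⟩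
      rw [h₄]
      simp [mul_assoc]
  choose X hX₁ hX₂ using hw
  obtain ⟨e, he⟩ := exists_surjective_nat ((Fin k → ℕ) × (Fin k → ℕ))
  let A : ℕ → Λ := fun n => Nat.rec 1 (fun n y => y * X (e n)) n
  have hAs : ∀ n, A (n + 1) = A n * X (e n) := fun n => rfl
  have hdeg : ∀ n c, n ≤ deg d (A n) c := by
    intro n c
    induction n with
    | zero => exact zero_le
    | succ n ih =>
      rw [hAs, deg_mul]
      exact add_le_add ih (hX₁ _ c)
  obtain ⟨x, hx⟩ := H.exists_infinitePath A (fun n => ⟨_, hAs n⟩) hdeg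
  refine ⟨x, fun p q hpq heq => ?_⟩
  obtain ⟨n, hn⟩ := he (p, q)
  have hAn := hAs n
  rw [hn] at hAn
  obtain ⟨α, β, γ, α', β', γ', h₁, h₂, h₃, h₄, h₅, h₆⟩ := hX₂ (p, q) hpq
  -- The block refuting (p, q) starts at deg(A n); the two shifts show β and β' there.
  have h := congrArg (fun y => y.seg (deg d (A n)) (deg d (A n) + deg d β) le_self_add) heq
  simp only [shift] at h
  rw [hx (n + 1) _ _ _ (A n * α) β γ (by rw [hAn, h₅]; simp [mul_assoc]) (by simp [h₁])
    (by simp [add_right_comm]), hx (n + 1) _ _ _ (A n * α') β' γ'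
    (by rw [hAn, h₆]; simp [mul_assoc]) (by simp [h₂]) (by simp [h₃, add_right_comm])] at h
  exact h₄ h

end UniqueFactorization

end InfinitePath

/-! ### Unique factorization in `𝔽_R⁺` -/

namespace YangBaxter

variable {X : Type*} {R : X × X → X × X} {k : ℕ}

/-! ### The action of letters on tuples of words -/

/-- Move a letter `t` from the left of a word to its right, exchanging it with each letter by
`S`. -/
def passWord (S : X × X → X × X) : List X → X → List X × X
  | [], t => ([], t)
  | r :: L, t =>
    ((S (t, r)).1 :: (passWord S L (S (t, r)).2).1, (passWord S L (S (t, r)).2).2)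

theorem length_passWord (S : X × X → X × X) (L : List X) (t : X) :
    (passWord S L t).1.length = L.length := by
  induction L generalizing t with
  | nil => rfl
  | cons r L ih => simp [passWord, ih]

/-- Left multiplication by the generator `(i, t)` on normal forms `e⁰_{u₀} e¹_{u₁} ⋯`. -/
def letterAct (S : X × X → X × X) : (k : ℕ) → Fin k → X → (Fin k → List X) → Fin k → List X
  | 0, _, _, u => u
  | k + 1, i, t, u =>
    Fin.cases (motive := fun _ => Fin (k + 1) → List X) (Fin.cons (t :: u 0) (Fin.tail u))
      (fun j => Fin.cons (passWord S (u 0) t).1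
        (letterAct S k j (passWord S (u 0) t).2 (Fin.tail u))) i

theorem letterAct_zero (S : X × X → X × X) (t : X) (u : Fin (k + 1) → List X) :
    letterAct S (k + 1) 0 t u = Fin.cons (t :: u 0) (Fin.tail u) := rfl

theorem letterAct_succ (S : X × X → X × X) (j : Fin k) (t : X) (u : Fin (k + 1) → List X) :
    letterAct S (k + 1) j.succ t u = Fin.cons (passWord S (u 0) t).1
        (letterAct S k j (passWord S (u 0) t).2 (Fin.tail u)) := rfl

theorem length_letterAct (S : X × X → X × X) (i : Fin k) (t : X) (u : Fin k → List X)
    (c : Fin k) : (letterAct S k i t u c).length = (Pi.single i 1 : Fin k → ℕ) c + (u c).length := by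
  induction k generalizing t with
  | zero => exact i.elim0
  | succ k ih =>
    cases i using Fin.cases with
    | zero =>
      rw [letterAct_zero]
      cases c using Fin.cases with
      | zero => simp [add_comm]
      | succ c => simp [Fin.tail]
    | succ j =>
      rw [letterAct_succ]
      cases c using Fin.cases with
      | zero => simp [length_passWord]
      | succ c =>
        simp only [Fin.cons_succ]
        rw [ih]
        simp [Fin.tail, Pi.single_apply]

variable {S : X × X → X × X}

/-- A relation between two letters survives their passage through a word of a smaller colour. For a
single letter this is the Yang–Baxter equation, evaluated at the triple obtained after both have
passed. -/
theorem passWord_passWord (hR : IsSolution R) (hRS : ∀ w, R (S w) = w) (hSR : ∀ w, S (R w) = w)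
    (L : List X) {s t s' t' : X} (h : R (s, t) = (t', s')) :
    (passWord S (passWord S L t).1 s).1 = (passWord S (passWord S L s').1 t').1 ∧
      R ((passWord S (passWord S L t).1 s).2, (passWord S L t).2) =
        ((passWord S (passWord S L s').1 t').2, (passWord S L s').2) := by
  induction L generalizing s t s' t' with
  | nil => simpa [passWord] using h
  | cons r L ih =>
    simp only [passWord]
    have h₁ := hRS (t, r)
    generalize S (t, r) = w₁ at h₁ ⊢
    obtain ⟨r₁, t₁⟩ := w₁
    dsimp only at h₁ ⊢
    have h₂ := hRS (s, r₁)
    generalize S (s, r₁) = w₂ at h₂ ⊢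
    obtain ⟨r₂, s₁⟩ := w₂
    dsimp only at h₂ ⊢
    have h₃ : ∃ w, R (s₁, t₁) = w := ⟨_, rfl⟩
    obtain ⟨⟨p, q⟩, h₃⟩ := h₃
    have hb := congrFun hR.braid (r₂, s₁, t₁)
    simp only [Function.comp_apply, leg12, leg23, h₁, h₂, h₃, h, Prod.mk.injEq] at hb
    have e₁ : R ((R (r₂, p)).2, q) = (s', r) := hb.2.symm
    have e₂ : S (s', r) = ((R (r₂, p)).2, q) := by rw [← e₁, hSR]
    have e₃ : S (t', (R (r₂, p)).2) = (r₂, p) := by rw [hb.1, Prod.mk.eta, hSR]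
    simp only [e₂, e₃]
    obtain ⟨k₁, k₂⟩ := ih h₃
    exact ⟨by rw [k₁], k₂⟩

theorem letterAct_letterAct (hR : IsSolution R) (hRS : ∀ w, R (S w) = w)
    (hSR : ∀ w, S (R w) = w) {i j : Fin k} (hij : i < j) {s t s' t' : X}
    (h : R (s, t) = (t', s')) (u : Fin k → List X) :
    letterAct S k i s (letterAct S k j t u) = letterAct S k j t' (letterAct S k i s' u) := by
  induction k generalizing s t s' t' with
  | zero => exact i.elim0
  | succ k ih =>
    cases j using Fin.cases with
    | zero => exact absurd hij (Fin.not_lt_zero i)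
    | succ j =>
      cases i using Fin.cases with
      | zero =>
        have e : S (t', s') = (s, t) := by rw [← h, hSR]
        simp [letterAct_zero, letterAct_succ, passWord, e]
      | succ i =>
        obtain ⟨h₁, h₂⟩ := passWord_passWord hR hRS hSR (u 0) h
        simp only [letterAct_succ, Fin.cons_zero, Fin.tail_cons, h₁]
        rw [ih (Fin.succ_lt_succ_iff.1 hij) h₂]

/-- Letters of the higher colours act first: they pass the still empty word of colour 0 unchanged.
The letters of colour 0 are then prepended. -/
theorem exists_foldr_letterAct (S : X × X → X × X) (u : Fin k → List X) :
    ∃ l : List (Fin k × X), l.foldr (fun g => letterAct S k g.1 g.2) (fun _ => []) = u := by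
  induction k with
  | zero => exact ⟨[], Subsingleton.elim _ _⟩
  | succ k ih =>
    obtain ⟨l, hl⟩ := ih (Fin.tail u)
    have h₁ : (l.map fun g => (g.1.succ, g.2)).foldr (fun g => letterAct S (k + 1) g.1 g.2)
        (fun _ => []) = Fin.cons [] (Fin.tail u) := by
      rw [← hl]
      clear hl
      induction l with
      | nil => ext c; cases c using Fin.cases <;> rfl
      | cons g l ih => simp [ih, letterAct_succ, passWord]
    have h₂ : ∀ L : List X, (L.map fun t => ((0 : Fin (k + 1)), t)).foldr
        (fun g => letterAct S (k + 1) g.1 g.2) (Fin.cons [] (Fin.tail u)) =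
          Fin.cons L (Fin.tail u) := by
      intro L
      induction L with
      | nil => rfl
      | cons t L ih => simp [ih, letterAct_zero]
    refine ⟨(u 0).map (fun t => (0, t)) ++ l.map fun g => (g.1.succ, g.2), ?_⟩
    rw [List.foldr_append, h₁, h₂, Fin.cons_self_tail]

/-! ### Factorization by counting the elements of each degree -/

namespace KGraph

open InfinitePath

@[elab_as_elim]
theorem induction_on {P : KGraph R k → Prop} (x : KGraph R k) (one : P 1)
    (edge_mul : ∀ i s y, P y → P (edge R i s * y)) : P x := by
  obtain ⟨l, rfl⟩ := PresentedMonoid.surjective_mk x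
  induction l using FreeMonoid.inductionOn' with
  | one => exact one
  | of_mul g l ih => rw [map_mul]; exact edge_mul g.1 g.2 _ ih

@[simp]
theorem deg_edge (i : Fin k) (s : X) : deg (degree R k) (edge R i s) = Pi.single i 1 := rfl

@[simp]
theorem deg_word (i : Fin k) {l : ℕ} (u : Fin l → X) :
    deg (degree R k) (word R i u) = Pi.single i l := by
  induction l with
  | zero => simp [word]
  | succ l ih => rw [word_succ, deg_mul, deg_edge, ih, ← Pi.single_add, add_comm]

theorem exists_eq_single_add {p : Fin k → ℕ} (hp : ∑ c, p c ≠ 0) :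
    ∃ (i : Fin k) (p' : Fin k → ℕ), p = Pi.single i 1 + p' := by
  obtain ⟨i, -, hi⟩ := Finset.exists_ne_zero_of_sum_ne_zero hp
  have hle : Pi.single i 1 ≤ p := by
    intro c
    by_cases hc : c = i
    · subst hc; simpa using Nat.one_le_iff_ne_zero.2 hi
    · simp [hc]
  exact ⟨i, p - Pi.single i 1, (add_tsub_cancel_of_le hle).symm⟩

/-- An edge of a given colour may be moved to the front. -/
theorem exists_edge_mul (hR : Function.Surjective R) {i : Fin k} (x : KGraph R k)
    (hx : deg (degree R k) x i ≠ 0) : ∃ s y, x = edge R i s * y := by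
  induction x using induction_on with
  | one => simp at hx
  | edge_mul c t y ih =>
    by_cases hc : c = i
    · exact ⟨t, y, by rw [hc]⟩
    · obtain ⟨s, z, rfl⟩ := ih (by simpa [Pi.single_apply, Ne.symm hc] using hx)
      rcases lt_or_gt_of_ne hc with h | h
      · exact ⟨_, _, by rw [← mul_assoc, edge_mul_edge R h, mul_assoc]⟩
      · obtain ⟨⟨p, q⟩, hpq⟩ := hR (t, s)
        refine ⟨p, edge R c q * z, ?_⟩
        rw [← mul_assoc, ← mul_assoc, edge_mul_edge R h, hpq]

theorem exists_mul (hR : Function.Surjective R) (x : KGraph R k) (p q : Fin k → ℕ)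
    (hx : deg (degree R k) x = p + q) :
    ∃ a b, x = a * b ∧ deg (degree R k) a = p ∧ deg (degree R k) b = q := by
  obtain ⟨n, hn⟩ : ∃ n, ∑ c, p c = n := ⟨_, rfl⟩
  induction n generalizing p x with
  | zero =>
    have hp : p = 0 := by
      ext c
      exact (Finset.sum_eq_zero_iff.1 hn) c (Finset.mem_univ c)
    exact ⟨1, x, by simp, by simp [hp], by simpa [hp] using hx⟩
  | succ n ih =>
    obtain ⟨i, p, rfl⟩ := exists_eq_single_add (p := p) (by omega)
    obtain ⟨s, y, rfl⟩ := exists_edge_mul (i := i) hR x (by simp [hx])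
    obtain ⟨a, b, rfl, ha, hb⟩ := ih y p (by simpa [add_assoc] using hx)
      (by simpa [Finset.sum_add_distrib, add_comm] using hn)
    exact ⟨edge R i s * a, b, by rw [mul_assoc], by simp [ha], hb⟩

theorem exists_word (hR : Function.Surjective R) (i : Fin k) (n : ℕ) (x : KGraph R k)
    (hx : deg (degree R k) x = Pi.single i n) : ∃ u : Fin n → X, x = word R i u := by
  induction n generalizing x with
  | zero =>
    refine ⟨Fin.elim0, ?_⟩
    induction x using induction_on with
    | one => simp [word]
    | edge_mul c t y => simpa using congrFun hx c
  | succ n ih =>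
    obtain ⟨s, y, rfl⟩ := exists_edge_mul (i := i) hR x (by simp [hx])
    rw [deg_mul, deg_edge, add_comm n, Pi.single_add] at hx
    obtain ⟨u, rfl⟩ := ih y (add_left_cancel hx)
    exact ⟨Fin.cons s u, by simp [word_succ]⟩

/-- The normal form of an element. -/
noncomputable def normalForm (hR : IsSolution R) (x : KGraph R k) : Fin k → List X :=
  PresentedMonoid.lift (M := Function.End (Fin k → List X))
    (fun g => letterAct (Function.surjInv hR.bijective.2) k g.1 g.2) (by
      rintro _ _ ⟨i, j, hij, s, t, s', t', h⟩
      funext u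
      exact letterAct_letterAct hR (Function.surjInv_eq hR.bijective.2)
        (Function.leftInverse_surjInv hR.bijective) hij h u) x fun _ => []

theorem normalForm_edge_mul (hR : IsSolution R) (i : Fin k) (s : X) (x : KGraph R k) :
    normalForm hR (edge R i s * x) =
      letterAct (Function.surjInv hR.bijective.2) k i s (normalForm hR x) := by
  unfold normalForm
  rw [map_mul]
  rfl

theorem length_normalForm (hR : IsSolution R) (x : KGraph R k) (c : Fin k) :
    (normalForm hR x c).length = deg (degree R k) x c := by
  induction x using induction_on with
  | one => rfl
  | edge_mul i s x ih => simp [normalForm_edge_mul, length_letterAct, ih]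

theorem normalForm_surjective (hR : IsSolution R) :
    Function.Surjective (normalForm (k := k) hR) := by
  intro u
  obtain ⟨l, rfl⟩ := exists_foldr_letterAct (Function.surjInv hR.bijective.2) u
  refine ⟨(l.map fun g => edge R g.1 g.2).prod, ?_⟩
  induction l with
  | nil => rfl
  | cons g l ih => simp [normalForm_edge_mul, ih]

theorem finite_and_ncard_deg_le [Finite X] (hR : Function.Surjective R) (p : Fin k → ℕ) :
    {x | deg (degree R k) x = p}.Finite ∧
      {x | deg (degree R k) x = p}.ncard ≤ Nat.card X ^ ∑ c, p c := by
  obtain ⟨n, hn⟩ : ∃ n, ∑ c, p c = n := ⟨_, rfl⟩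
  induction n generalizing p with
  | zero =>
    have hp : p = 0 := by
      ext c
      exact (Finset.sum_eq_zero_iff.1 hn) c (Finset.mem_univ c)
    have : {x | deg (degree R k) x = p} ⊆ {1} := by
      intro x hx
      induction x using induction_on with
      | one => rfl
      | edge_mul c t y =>
        have := congrFun (Set.mem_ofPred.1 hx) c
        simp [hp] at this
    refine ⟨(Set.finite_singleton _).subset this, ?_⟩
    rw [hn]
    simpa using Set.ncard_le_ncard this
  | succ n ih =>
    obtain ⟨i, p, rfl⟩ := exists_eq_single_add (p := p) (by omega)
    have hn' : ∑ c, p c = n := by simpa [Finset.sum_add_distrib, add_comm] using hn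
    obtain ⟨hf, hc⟩ := ih p hn'
    have hsub : {x | deg (degree R k) x = Pi.single i 1 + p} ⊆
        (fun w : X × KGraph R k => edge R i w.1 * w.2) ''
          (Set.univ ×ˢ {x | deg (degree R k) x = p}) := by
      intro x hx
      rw [Set.mem_ofPred] at hx
      obtain ⟨s, y, rfl⟩ := exists_edge_mul (i := i) hR x (by simp [hx])
      exact ⟨(s, y), ⟨trivial, by simpa using hx⟩, rfl⟩
    have hfin : (Set.univ ×ˢ {x | deg (degree R k) x = p} : Set (X × KGraph R k)).Finite :=
      Set.finite_univ.prod hf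
    refine ⟨(hfin.image _).subset hsub, ?_⟩
    refine (Set.ncard_le_ncard hsub (hfin.image _)).trans ((Set.ncard_image_le hfin).trans ?_)
    rw [Set.ncard_prod, Set.ncard_univ, hn, pow_succ', ← hn']
    exact Nat.mul_le_mul_left _ hc

/-- The upper bound comes from pulling edges to the front; the lower bound holds because every tuple
of words with lengths p is a normal form. -/
theorem ncard_deg [Finite X] (hR : IsSolution R) (p : Fin k → ℕ) :
    {x | deg (degree R k) x = p}.ncard = Nat.card X ^ ∑ c, p c := by
  have := Fintype.ofFinite X
  obtain ⟨hf, hle⟩ := finite_and_ncard_deg_le (k := k) hR.bijective.2 p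
  refine le_antisymm hle ?_
  have hcard : {u : Fin k → List X | ∀ c, (u c).length = p c}.ncard =
      Nat.card X ^ ∑ c, p c := by
    rw [← Nat.card_coe_set_eq]
    refine (Nat.card_congr (Equiv.subtypePiEquivPi
      (p := fun c (l : List X) => l.length = p c))).trans ?_
    rw [Nat.card_pi, ← Finset.prod_pow_eq_pow_sum]
    refine Finset.prod_congr rfl fun c _ => ?_
    have : Nat.card (List.Vector X (p c)) = Nat.card X ^ p c := by
      rw [Nat.card_eq_fintype_card, Nat.card_eq_fintype_card, card_vector]
    exact this
  rw [← hcard]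
  have : {u : Fin k → List X | ∀ c, (u c).length = p c} ⊆
      normalForm hR '' {x | deg (degree R k) x = p} := by
    intro u hu
    obtain ⟨x, rfl⟩ := normalForm_surjective hR u
    exact ⟨x, funext fun c => by rw [← hu c, length_normalForm], rfl⟩
  exact (Set.ncard_le_ncard this (hf.image _)).trans (Set.ncard_image_le hf)

theorem uniqueFactorization [Finite X] [Nonempty X] (hR : IsSolution R) :
    UniqueFactorization (degree R k) where
  exists_mul := exists_mul hR.bijective.2
  cancel a b a' b' h e := by
    set p := deg (degree R k) a with hp
    set q := deg (degree R k) b with hq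
    have hb : deg (degree R k) b' = q := by
      have := congrArg (deg (degree R k)) e
      rw [deg_mul, deg_mul, ← h] at this
      exact (add_left_cancel this).symm
    have hfin := ((finite_and_ncard_deg_le (k := k) hR.bijective.2 p).1.prod
      (finite_and_ncard_deg_le (k := k) hR.bijective.2 q).1)
    have himage : (fun w : KGraph R k × KGraph R k => w.1 * w.2) ''
        ({x | deg (degree R k) x = p} ×ˢ {x | deg (degree R k) x = q}) =
          {x | deg (degree R k) x = p + q} := by
      ext x
      constructor
      · rintro ⟨w, ⟨h₁, h₂⟩, rfl⟩
        rw [Set.mem_ofPred] at h₁ h₂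
        simp [h₁, h₂]
      · intro hx
        obtain ⟨a, b, rfl, ha, hb⟩ := exists_mul hR.bijective.2 x p q hx
        exact ⟨(a, b), ⟨ha, hb⟩, rfl⟩
    -- Multiplication maps onto the elements of degree p + q, and both sides have |X|^{|p| + |q|}
    -- elements.
    have hinj := Set.injOn_of_ncard_image_eq (by
      rw [himage, Set.ncard_prod, ncard_deg hR, ncard_deg hR, ncard_deg hR, ← pow_add,
        ← Finset.sum_add_distrib]
      rfl) hfin
    have h₁ : (a, b) ∈ {x | deg (degree R k) x = p} ×ˢ {x | deg (degree R k) x = q} :=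
      ⟨hp.symm, hq.symm⟩
    have h₂ : (a', b') ∈ {x | deg (degree R k) x = p} ×ˢ {x | deg (degree R k) x = q} :=
      ⟨h.symm, hb⟩
    exact Prod.mk.inj (hinj h₁ h₂ e)
  exists_deg p := by
    have : 0 < {x | deg (degree R k) x = p}.ncard := by
      rw [ncard_deg hR]
      exact pow_pos Nat.card_pos _
    obtain ⟨x, hx⟩ := Set.nonempty_of_ncard_ne_zero this.ne'
    exact ⟨x, hx⟩

theorem edge_injective (hR : IsSolution R) (i : Fin k) :
    Function.Injective (edge R i : X → KGraph R k) := by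
  have key : ∀ (k : ℕ) (i : Fin k) (S : X × X → X × X) (s : X),
      letterAct S k i s (fun _ => []) i = [s] := by
    intro k i S s
    induction k with
    | zero => exact i.elim0
    | succ k ih =>
      cases i using Fin.cases with
      | zero => simp [letterAct_zero]
      | succ j =>
        rw [letterAct_succ]
        simp only [passWord, Fin.cons_succ]
        exact ih j
  intro s t h
  have h₁ := congrFun (congrArg (fun x => normalForm hR (x * 1)) h) i
  simp only [normalForm_edge_mul] at h₁
  have h₂ : normalForm hR (1 : KGraph R k) = fun _ => [] := rfl
  rw [h₂, key, key] at h₁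
  simpa using h₁

theorem word_injective [Finite X] [Nonempty X] (hR : IsSolution R) (i : Fin k) (n : ℕ) :
    Function.Injective (word R i : (Fin n → X) → KGraph R k) := by
  induction n with
  | zero => exact fun _ _ _ => Subsingleton.elim _ _
  | succ n ih =>
    intro u v h
    rw [word_succ, word_succ] at h
    obtain ⟨h₁, h₂⟩ := (uniqueFactorization hR).cancel _ _ _ _ (by simp) h
    rw [← Fin.cons_self_tail u, ← Fin.cons_self_tail v, edge_injective hR i h₁, ih h₂]

end KGraph

end YangBaxter

/-! ### Periods of `𝔽_R⁺` -/

namespace InfinitePath.UniqueFactorization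

variable {Λ : Type*} [Monoid Λ] {k : ℕ} {d : Λ →* Multiplicative (Fin k → ℕ)}

theorem cancel_right (H : UniqueFactorization d) (a b a' b' : Λ) (h : deg d b = deg d b')
    (e : a * b = a' * b') : a = a' ∧ b = b' := by
  refine H.cancel a b a' b' ?_ e
  have := congrArg (deg d) e
  rw [deg_mul, deg_mul, h] at this
  exact add_right_cancel this

end InfinitePath.UniqueFactorization

/-! ### Changing colours -/

namespace YangBaxter.KGraph

open InfinitePath

variable {X : Type*} {R : X × X → X × X} {k l : ℕ}

/-- The homomorphism of semigroups induced by an order-preserving injection of colours. -/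
def mapColour (R : X × X → X × X) (f : Fin k → Fin l) (hf : StrictMono f) :
    KGraph R k →* KGraph R l :=
  PresentedMonoid.lift (fun g : Fin k × X => edge R (f g.1) g.2) (by
    rintro _ _ ⟨i, j, hij, s, t, s', t', h⟩
    simp [edge_mul_edge R (hf hij), h])

variable {f f' : Fin k → Fin l} (hf : StrictMono f) (hf' : StrictMono f')

@[simp]
theorem mapColour_edge (i : Fin k) (s : X) : mapColour R f hf (edge R i s) = edge R (f i) s :=
  rfl

@[simp]
theorem mapColour_word (i : Fin k) {n : ℕ} (u : Fin n → X) :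
    mapColour R f hf (word R i u) = word R (f i) u := by
  induction n with
  | zero => simp [word]
  | succ n ih => rw [word_succ, word_succ, map_mul, ih, mapColour_edge]

include hf in
theorem extend_single (i : Fin k) (n : ℕ) :
    Function.extend f (Pi.single i n : Fin k → ℕ) 0 = Pi.single (f i) n := by
  ext c
  by_cases hc : ∃ j, f j = c
  · obtain ⟨j, rfl⟩ := hc
    rw [hf.injective.extend_apply]
    simp [Pi.single_apply, hf.injective.eq_iff]
  · rw [Function.extend_apply' _ _ _ hc, Pi.single_eq_of_ne]
    · rfl
    · rintro rfl
      exact hc ⟨i, rfl⟩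

theorem extend_add_zero (f : Fin k → Fin l) (p q : Fin k → ℕ) :
    Function.extend f (p + q) 0 = Function.extend f p 0 + Function.extend f q 0 := by
  rw [← Function.extend_add, add_zero]

@[simp]
theorem deg_mapColour (x : KGraph R k) :
    deg (degree R l) (mapColour R f hf x) = Function.extend f (deg (degree R k) x) 0 := by
  induction x using induction_on with
  | one =>
    ext c
    simp [Function.extend_def]
  | edge_mul i s y ih => simp [ih, extend_add_zero, extend_single hf]

theorem mapColour_congr {x : KGraph R k} (h : ∀ c, deg (degree R k) x c ≠ 0 → f c = f' c) :
    mapColour R f hf x = mapColour R f' hf' x := by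
  induction x using induction_on with
  | one => simp
  | edge_mul i s y ih =>
    rw [map_mul, map_mul, ih fun c hc => h c (by simp [hc]), mapColour_edge, mapColour_edge,
      h i (by simp)]

theorem exists_mapColour_eq {x : KGraph R l} {p : Fin k → ℕ}
    (hx : deg (degree R l) x = Function.extend f p 0) :
    ∃ y, x = mapColour R f hf y ∧ deg (degree R k) y = p := by
  have hsupp : ∀ c, deg (degree R l) x c ≠ 0 → ∃ j, f j = c := by
    intro c hc
    by_contra h
    rw [hx, Function.extend_apply' _ _ _ h] at hc
    exact hc rfl
  obtain ⟨y, rfl⟩ : ∃ y, x = mapColour R f hf y := by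
    clear hx
    induction x using induction_on with
    | one => exact ⟨1, by simp⟩
    | edge_mul i s z ih =>
      obtain ⟨y, rfl⟩ := ih fun c hc => hsupp c (by simp [hc])
      obtain ⟨j, rfl⟩ := hsupp i (by simp)
      exact ⟨edge R j s * y, by simp⟩
  refine ⟨y, rfl, ?_⟩
  ext c
  have := congrFun hx (f c)
  rwa [deg_mapColour, hf.injective.extend_apply, hf.injective.extend_apply] at this

variable [Finite X] [Nonempty X]

theorem mapColour_injective (hR : IsSolution R) : Function.Injective (mapColour R f hf) := by
  intro x y h
  have hdeg : deg (degree R k) x = deg (degree R k) y := by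
    ext c
    have := congrFun (congrArg (deg (degree R l)) h) (f c)
    rwa [deg_mapColour, deg_mapColour, hf.injective.extend_apply,
      hf.injective.extend_apply] at this
  induction x using induction_on generalizing y with
  | one => exact ((uniqueFactorization hR).eq_one (by rw [← hdeg, deg_one])).symm
  | edge_mul i s x ih =>
    obtain ⟨t, y, rfl⟩ := exists_edge_mul (i := i) hR.bijective.2 y (by simp [← hdeg])
    rw [map_mul, map_mul, mapColour_edge, mapColour_edge] at h
    obtain ⟨h₁, h₂⟩ := (uniqueFactorization hR).cancel _ _ _ _ (by simp) h
    rw [edge_injective hR _ h₁, ih h₂ (by simpa using hdeg)]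

/-! ### From a period to trivial level maps -/

/-- If `(a, b)` is a period then elements of degree `b`, written in two copies of the colours of
`b`, may be exchanged. -/
theorem mapColour_mul_mapColour (hR : IsSolution R) {a b : Fin k → ℕ}
    (hab : IsPeriod (degree R k) a b) (hff' : ∀ c, a c ≠ 0 → f c = f' c) {w v : KGraph R k}
    (hw : deg (degree R k) w = b) (hv : deg (degree R k) v = b) :
    mapColour R f hf w * mapColour R f' hf' v = mapColour R f' hf' w * mapColour R f hf v := by
  have H := uniqueFactorization (k := k) hR
  have H' := uniqueFactorization (k := l) hR
  obtain ⟨h, g, hh, hg, hhg⟩ := H.exists_exchange hab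
  set F := mapColour R f hf with hF
  set G := mapColour R f' hf' with hG
  have hFG : ∀ u, deg (degree R k) u = a → F u = G u := fun u hu =>
    mapColour_congr hf hf' fun c hc => hff' c (by rwa [hu] at hc)
  have key : ∀ v x, deg (degree R k) v = b → deg (degree R k) x = b →
      ∃ x' v', deg (degree R k) x' = b ∧ deg (degree R k) v' = b ∧ F v * G x = G x' * F v' ∧
        ∀ w, deg (degree R k) w = b → F w * G v = G w * F x' := by
    intro v x hv hx
    obtain ⟨x', v', e, hx₁, hv₁⟩ := H'.exists_mul (F v * G x) (Function.extend f' b 0)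
      (Function.extend f b 0) (by rw [deg_mul, deg_mapColour, deg_mapColour, hv, hx, add_comm])
    obtain ⟨x', rfl, hx'⟩ := exists_mapColour_eq hf' hx₁
    obtain ⟨v', rfl, hv'⟩ := exists_mapColour_eq hf hv₁
    refine ⟨x', v', hx', hv', e, fun w hw => ?_⟩
    obtain ⟨hu, hgw⟩ := hg w hw
    -- Exchange g(w) with v inside F. The resulting factor g(v) has degree a, so it passes from F to
    -- G, where it is exchanged with x.
    have e₁ : F (g w) * (F v * G x) = F w * G v * G (g x) := by
      rw [← mul_assoc, ← map_mul F, hhg _ _ hu hv, hgw, map_mul, hFG _ (hg v hv).1, mul_assoc,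
        ← map_mul G, hhg _ _ (hg v hv).1 hx, (hg v hv).2, map_mul, mul_assoc]
    have e₂ : F (g w) * (F v * G x) = G w * F x' * F (g v') := by
      rw [e, hFG _ hu, ← hG, ← mul_assoc, ← map_mul G, hhg _ _ hu hx', hgw, map_mul,
        ← hFG _ (hg x' hx').1, mul_assoc, ← hF, ← map_mul F, hhg _ _ (hg x' hx').1 hv',
        (hg x' hx').2, map_mul, mul_assoc]
    refine (H'.cancel_right _ _ _ _ ?_ (e₁.symm.trans e₂)).1
    rw [← hFG _ (hg x hx).1, deg_mapColour, deg_mapColour, (hg x hx).1, (hg v' hv').1]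
  -- With x = w = v, the element F(v) G(v) has the left factors G(x') and G(v) of equal degree,
  -- which gives x' = v.
  obtain ⟨x', v', hx', -, e, h₁⟩ := key v v hv hv
  have hxv : x' = v := by
    apply mapColour_injective hf' hR
    refine (H'.cancel _ _ _ _ ?_ (e.symm.trans (h₁ v hv))).1
    rw [deg_mapColour, deg_mapColour, hx', hv]
  rw [h₁ w hw, hxv]

theorem level_eq_id_of_isPeriod (hR : IsSolution R) {a b : Fin k → ℕ}
    (hab : IsPeriod (degree R k) a b) (hdisj : ∀ c, a c = 0 ∨ b c = 0) {c : Fin k}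
    (hc : b c ≠ 0) : level R (b c) (b c) = id := by
  -- Colour c is doubled to 2c and 2c + 1, and f' uses the odd copy only on the support of b, which
  -- is disjoint from that of a.
  let f : Fin k → Fin (2 * k) := fun c => ⟨2 * c, by omega⟩
  let f' : Fin k → Fin (2 * k) := fun c => ⟨if b c = 0 then 2 * c else 2 * c + 1, by
    split_ifs <;> omega⟩
  have hf : StrictMono f := fun i j hij => by
    simp only [f, Fin.mk_lt_mk]; omega
  have hf' : StrictMono f' := fun i j hij => by
    simp only [f', Fin.mk_lt_mk]; split_ifs <;> omega
  have hlt : f c < f' c := by simp [f, f', hc]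
  have hff' : ∀ c, a c ≠ 0 → f c = f' c := fun c h => by
    simp [f, f', (hdisj c).resolve_left h]
  have hexch := fun w v => mapColour_mul_mapColour hf hf' hR hab hff' (w := w) (v := v)
  have H := uniqueFactorization (k := k) hR
  have H' := uniqueFactorization (k := 2 * k) hR
  have hb : b = Pi.single c (b c) + (b - Pi.single c (b c)) :=
    (add_tsub_cancel_of_le fun i => by
      by_cases hi : i = c
      · subst hi; simp
      · simp [hi]).symm
  generalize b - Pi.single c (b c) = r at hb
  generalize b c = n at hb ⊢
  obtain ⟨z, hz⟩ := H.exists_deg r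
  have hex : ∀ x, deg (degree R (2 * k)) x =
      Function.extend f b 0 + Function.extend f' b 0 →
      ∃ w v, deg (degree R k) w = b ∧ deg (degree R k) v = b ∧
        x = mapColour R f hf w * mapColour R f' hf' v := by
    intro x hx
    obtain ⟨w, v, rfl, hw₁, hv₁⟩ := H'.exists_mul _ _ _ hx
    obtain ⟨w, rfl, hw⟩ := exists_mapColour_eq hf hw₁
    obtain ⟨v, rfl, hv⟩ := exists_mapColour_eq hf' hv₁
    exact ⟨w, v, hw, hv, rfl⟩
  funext ⟨p, q⟩
  have hpq := word_mul_word R hlt p q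
  set P := level R n n (p, q)
  have hfst : P.1 = p := by
    -- The elements z supply the rest of degree b. Both p and `P.1` are then the initial word of
    -- colour c of the same w.
    obtain ⟨w, v, hw, hv, e⟩ := hex (word R (f c) p * word R (f' c) q *
      (mapColour R f hf z * mapColour R f' hf' z)) (by
        simp only [deg_mul, deg_word, deg_mapColour, hz, hb, extend_add_zero, extend_single hf,
          extend_single hf']
        abel)
    have e' := e
    rw [hexch _ _ hw hv, hpq] at e'
    obtain ⟨y, w, rfl, hy, -⟩ := H.exists_mul w _ _ (hw.trans hb)
    obtain ⟨u, rfl⟩ := exists_word hR.bijective.2 _ _ _ hy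
    simp only [map_mul, mapColour_word, mul_assoc] at e e'
    rw [word_injective hR _ _ (H'.cancel _ _ _ _ (by simp) e).1,
      word_injective hR _ _ (H'.cancel _ _ _ _ (by simp) e').1]
  have hsnd : P.2 = q := by
    -- With the padding on the left, q and `P.2` are both the final word of colour c of v.
    obtain ⟨w, v, hw, hv, e⟩ := hex ((mapColour R f hf z * mapColour R f' hf' z) *
      (word R (f c) p * word R (f' c) q)) (by
        simp only [deg_mul, deg_word, deg_mapColour, hz, hb, extend_add_zero, extend_single hf,
          extend_single hf']
        abel)
    have e' := e
    rw [hexch _ _ hw hv, hpq] at e'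
    obtain ⟨v, y, rfl, -, hy⟩ := H.exists_mul v _ _ (hv.trans (hb.trans (add_comm _ _)))
    obtain ⟨u, rfl⟩ := exists_word hR.bijective.2 _ _ _ hy
    simp only [map_mul, mapColour_word, ← mul_assoc] at e e'
    rw [word_injective hR _ _ (H'.cancel_right _ _ _ _ (by simp) e).2,
      word_injective hR _ _ (H'.cancel_right _ _ _ _ (by simp) e').2]
  exact Prod.ext hfst hsnd

/-! ### From a trivial level map to a period -/

omit [Finite X] [Nonempty X] in
theorem word_mul_word_of_level_eq_id {n : ℕ} (h : level R n n = id) (i j : Fin k)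
    (u v : Fin n → X) : word R i u * word R j v = word R j u * word R i v := by
  rcases lt_trichotomy i j with hij | rfl | hij
  · rw [word_mul_word R hij, h]; rfl
  · rfl
  · rw [word_mul_word R hij, h]; rfl

/-- Each block e^c_s of x is passed by e^j_v e^c_s = e^c_v e^j_s, in which the colour j moves on and
the letters stay. The point is that y and t do not depend on j. -/
theorem exists_word_mul_eq_mul_word (hR : IsSolution R) {n : ℕ} (h : level R n n = id)
    (m : Fin k → ℕ) (x : KGraph R k) (hx : deg (degree R k) x = n • m) (v : Fin n → X) :
    ∃ (y : KGraph R k) (t : Fin n → X), deg (degree R k) y = n • m ∧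
      ∀ j, word R j v * x = y * word R j t := by
  have H := uniqueFactorization (k := k) hR
  obtain ⟨N, hN⟩ : ∃ N, ∑ c, m c = N := ⟨_, rfl⟩
  induction N generalizing m x v with
  | zero =>
    have hm : m = 0 := by
      ext c
      exact (Finset.sum_eq_zero_iff.1 hN) c (Finset.mem_univ c)
    subst hm
    exact ⟨1, v, by simp, fun j => by rw [H.eq_one (hx.trans (smul_zero n))]; simp⟩
  | succ N ih =>
    obtain ⟨c, m, rfl⟩ := exists_eq_single_add (p := m) (by omega)
    have hc : n • (Pi.single c 1 : Fin k → ℕ) = Pi.single c n := by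
      rw [← Pi.single_smul]; simp
    rw [smul_add, hc] at hx
    obtain ⟨s, x, rfl, hs, hx₁⟩ := H.exists_mul _ _ _ hx
    obtain ⟨s, rfl⟩ := exists_word hR.bijective.2 _ _ _ hs
    obtain ⟨y, t, hy, e⟩ := ih m x hx₁ s (by simpa [Finset.sum_add_distrib, add_comm] using hN)
    refine ⟨word R c v * y, t, by simp [smul_add, hc, hy], fun j => ?_⟩
    rw [← mul_assoc, word_mul_word_of_level_eq_id h, mul_assoc, e, mul_assoc]

theorem isPeriod_of_level_eq_id (hR : IsSolution R) {n : ℕ} (hn : 1 ≤ n)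
    (h : level R n n = id) (i j : Fin k) :
    IsPeriod (degree R k) (Pi.single i n) (Pi.single j n) := by
  have H := uniqueFactorization (k := k) hR
  intro α β γ α' β' γ' hα hα' hβ e
  set D := deg (degree R k) (α * β * γ) with hD
  have hDn : D ≤ n • D := fun c => by
    simpa using Nat.le_mul_of_pos_left (D c) hn
  -- This degree makes β γ δ have degree nε_j + nD: a word of colour j followed by an x of degree
  -- nD. Then β γ δ and β' γ' δ turn out to share a left factor y of degree nD, which is at least
  -- the degree of β.
  obtain ⟨δ, hδ⟩ := H.exists_deg (Pi.single i n + Pi.single j n + (n • D - D))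
  have hdeg : deg (degree R k) (β * γ * δ) = Pi.single j n + n • D := by
    refine add_left_cancel (a := deg (degree R k) α) ?_
    rw [← deg_mul, ← mul_assoc, ← mul_assoc, deg_mul, ← hD, hδ, hα,
      add_left_comm, add_tsub_cancel_of_le hDn, add_assoc]
  obtain ⟨v, x, e₁, hv, hx⟩ := H.exists_mul _ _ _ hdeg
  obtain ⟨v, rfl⟩ := exists_word hR.bijective.2 _ _ _ hv
  obtain ⟨u, rfl⟩ := exists_word hR.bijective.2 _ _ _ hα
  obtain ⟨y, t, hy, hyt⟩ := exists_word_mul_eq_mul_word hR h D x hx v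
  have e₂ : α' * (β' * γ' * δ) = word R j u * (word R i v * x) := by
    rw [← mul_assoc, ← mul_assoc, ← e, ← mul_assoc (word R j u),
      ← word_mul_word_of_level_eq_id h, mul_assoc (word R i u), mul_assoc (word R i u), e₁,
      mul_assoc]
  have e₃ := (H.cancel _ _ _ _ (by rw [hα', deg_word]) e₂).2
  have hβD : deg (degree R k) β ≤ deg (degree R k) y := by
    rw [hy]
    refine le_trans ?_ hDn
    rw [hD, deg_mul, deg_mul, add_right_comm]
    exact le_add_self
  obtain ⟨β₀, z, rfl, hβ₀, -⟩ := H.exists_mul_of_le hβD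
  rw [hyt, mul_assoc, mul_assoc] at e₁ e₃
  rw [(H.cancel _ _ _ _ hβ₀.symm e₁).1, (H.cancel _ _ _ _ (hβ.symm.trans hβ₀.symm) e₃).1]

end YangBaxter.KGraph

/-- Periodicity of a solution `R` means periodicity of its associated `k`-graph for some, or
equivalently every, `k ≥ 2`; the claim is therefore made for each `k ≥ 2`. -/
theorem corollary4p10 (N : ℕ) (hN : 1 ≤ N) (R : Fin N × Fin N → Fin N × Fin N)
    (hR : YangBaxter.IsSolution R) (k : ℕ) (hk : 2 ≤ k) :
    IsPeriodicKGraph (YangBaxter.KGraph.degree R k) ↔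
      ∃ n : ℕ, 1 ≤ n ∧ YangBaxter.level R n n = id := by
  have : NeZero N := ⟨by omega⟩
  have H := YangBaxter.KGraph.uniqueFactorization (k := k) hR
  constructor
  · intro h
    by_contra! hlevel
    refine h (H.isAperiodicKGraph fun p q hpq hper => hpq ?_)
    -- Subtracting p ⊓ q makes the supports disjoint; a nonzero entry n on either side would then
    -- give R^{n,n} = id.
    have hab : InfinitePath.IsPeriod (YangBaxter.KGraph.degree R k) (p - p ⊓ q) (q - p ⊓ q) :=
      H.isPeriod_of_add (r := p ⊓ q) (by
        rwa [add_tsub_cancel_of_le inf_le_left, add_tsub_cancel_of_le inf_le_right])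
    have hdisj : ∀ c, (p - p ⊓ q) c = 0 ∨ (q - p ⊓ q) c = 0 := fun c => by
      simp only [Pi.sub_apply, Pi.inf_apply]
      omega
    ext c
    have h₁ : (p - p ⊓ q) c = 0 := by
      by_contra h₁
      exact hlevel _ (Nat.one_le_iff_ne_zero.2 h₁)
        (YangBaxter.KGraph.level_eq_id_of_isPeriod hR hab.symm (fun c => (hdisj c).symm) h₁)
    have h₂ : (q - p ⊓ q) c = 0 := by
      by_contra h₂
      exact hlevel _ (Nat.one_le_iff_ne_zero.2 h₂)
        (YangBaxter.KGraph.level_eq_id_of_isPeriod hR hab hdisj h₂)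
    simp only [Pi.sub_apply, Pi.inf_apply] at h₁ h₂
    omega
  · rintro ⟨n, hn, h⟩ ⟨x, hx⟩
    have hij : (⟨0, by omega⟩ : Fin k) ≠ ⟨1, by omega⟩ := by simp
    refine hx (Pi.single ⟨0, by omega⟩ n) (Pi.single ⟨1, by omega⟩ n) (fun e => ?_)
      (H.shift_eq_of_isPeriod (YangBaxter.KGraph.isPeriod_of_level_eq_id hR hn h _ _) x)
    have := congrFun e ⟨0, by omega⟩
    rw [Pi.single_eq_same, Pi.single_eq_of_ne hij] at this
    omega
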